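/- Lemma (1-Step Coupling). Let $k\le n$ be natural numbers and let $\mathcal C$ be the set of configurations of $n$ nodes with opinions in $[k]=\{1,\dots,k\}$, i.e. of all vectors $c\in\mathbb N_0^n$ with $\sum_{i=1}^n c_i=n$ and $c_i=0$ for $i>k$ (the number $c_i$ counts the nodes supporting opinion $i$). For $x,y\in\mathbb R^d$ write $x\succeq y$ ($x$ majorizes $y$) if $\sum_{i=1}^d x_i=\sum_{i=1}^d y_i$ and, for every $l\in\{1,\dots,d\}$, the sum of the $l$ largest components of $x$ is at least the sum of the $l$ largest components of $y$. An anonymous consensus process (AC-process) $P_\alpha$ is given by a process function $\alpha\colon\mathcal C\to[0,1]^n$ with $\sum_{i=1}^n\alpha_i(c)=1$ and $\alpha_i(c)=0$ for $i>k$, for all $c\in\mathcal C$: in one round from configuration $c$, each of the $n$ nodes independently adopts opinion $i\in[k]$ with probability $\alpha_i(c)$, and the successor configuration counts the nodes supporting each opinion. Let $P_\alpha$ and $P_{\tilde\alpha}$ be two AC-processes and let $c,\tilde c\in\mathcal C$ be any two configurations with $\alpha(c)\succeq\tilde\alpha(\tilde c)$. Let $c'$ and $\tilde c'$ be the random configurations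 of $P_\alpha$ and $P_{\tilde\alpha}$ after one round started from $c$ and $\tilde c$, respectively. Then there is a coupling of $c'$ and $\tilde c'$ (a pair of $\mathcal C$-valued random variables on a common probability space having the laws of $c'$ and $\tilde c'$, respectively) such that $c'\succeq\tilde c'$ holds surely. -/

import Mathlib

open MeasureTheory

/-- The components of `x` rearranged in non-increasing order. -/
noncomputable def sortDown {d : ℕ} (x : Fin d → ℝ) : Fin d → ℝ :=
  x ∘ Tuple.sort (fun i => -x i)

theorem sortDown_antitone {d : ℕ} (x : Fin d → ℝ) : Antitone (sortDown x) := by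
  intro i j hij
  have h := Tuple.monotone_sort (fun i => -x i) hij
  simpa [sortDown] using h

/-- `Majorizes x y` is vector majorization `x ⪰ y`: for every `l`, the sum of the `l` largest
components of `x` is at least that of `y`, and the total sums agree. -/
def Majorizes {d : ℕ} (x y : Fin d → ℝ) : Prop :=
  (∀ l : Fin d, ∑ i ∈ Finset.Iic l, sortDown y i ≤ ∑ i ∈ Finset.Iic l, sortDown x i) ∧
    ∑ i, x i = ∑ i, y i

/-- The opinions `i ∈ [k]`, as those coordinates of `n`-dimensional vectors which are among the
first `k`. -/
abbrev Opinion (n k : ℕ) : Type := {i : Fin n // i.val < k}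

/-- Configurations of `n` nodes with opinions in `[k]`: vectors `c ∈ ℕ₀ⁿ` with `∑ i, c i = n` and
`c i = 0` for every coordinate beyond the first `k`. -/
abbrev Config (n k : ℕ) : Type :=
  {c : Fin n → ℕ // ∑ i, c i = n ∧ ∀ i : Fin n, k ≤ i.val → c i = 0}

/-- A configuration as a real vector. -/
noncomputable def Config.toReal {n k : ℕ} (c : Config n k) : Fin n → ℝ := fun i => (c.1 i : ℝ)

/-- The configuration that counts, for each opinion, the nodes supporting it. -/
def Config.tally {n k : ℕ} (ω : Fin n → Opinion n k) : Config n k :=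
  ⟨fun i => (Finset.univ.filter fun v => (ω v).1 = i).card, by
    constructor
    · have h := Finset.card_eq_sum_card_fiberwise (f := fun v => (ω v).1)
        (s := (Finset.univ : Finset (Fin n))) (t := (Finset.univ : Finset (Fin n)))
        (fun v _ => by simp)
      simpa using h.symm
    · intro i hi
      rw [Finset.card_eq_zero, Finset.filter_eq_empty_iff]
      intro v _ hv
      have := (ω v).2
      rw [hv] at this
      omega⟩

/-- An anonymous consensus process on `n` nodes with opinions in `[k]`, given by its process
function `α`, which assigns to each configuration a probability vector on the opinions. -/
structure ACProcess (n k : ℕ) where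
  /-- the process function -/
  α : Config n k → Fin n → ℝ
  nonneg : ∀ c i, 0 ≤ α c i
  sum_eq_one : ∀ c, ∑ i, α c i = 1
  eq_zero_of_le : ∀ c (i : Fin n), k ≤ i.val → α c i = 0

namespace ACProcess

variable {n k : ℕ}

theorem sum_opinion (P : ACProcess n k) (c : Config n k) :
    ∑ i : Opinion n k, ENNReal.ofReal (P.α c i.1) = 1 := by
  rw [← ENNReal.ofReal_sum_of_nonneg (fun i _ => P.nonneg c i.1)]
  have h : ∑ i : Opinion n k, P.α c i.1 = ∑ i, P.α c i := by
    rw [← Finset.sum_filter_add_sum_filter_not Finset.univ (fun i : Fin n => i.val < k) (P.α c),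
      Finset.sum_eq_zero (s := Finset.univ.filter fun i : Fin n => ¬ i.val < k)
        (fun i hi => P.eq_zero_of_le c i (by simpa using hi)), add_zero]
    exact (Finset.sum_subtype _ (by simp) _).symm
  rw [h, P.sum_eq_one, ENNReal.ofReal_one]

/-- The law of the opinion adopted by a single node in configuration `c`. -/
noncomputable def opinionLaw (P : ACProcess n k) (c : Config n k) : PMF (Opinion n k) :=
  PMF.ofFintype (fun i => ENNReal.ofReal (P.α c i.1)) (P.sum_opinion c)

/-- The law of the configuration after one round from `c`: the nodes independently adopt
opinions according to `opinionLaw`, and the resulting supports are counted. -/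
noncomputable def stepLaw (P : ACProcess n k) (c : Config n k) : Measure (Config n k) :=
  (Measure.pi fun _ : Fin n => (P.opinionLaw c).toMeasure).map Config.tally

theorem measurable_tally : Measurable (Config.tally : (Fin n → Opinion n k) → Config n k) :=
  measurable_of_countable _

instance (P : ACProcess n k) (c : Config n k) : IsProbabilityMeasure (P.stepLaw c) :=
  Measure.isProbabilityMeasure_map measurable_tally.aemeasurable

end ACProcess

/-! By Hardy, Littlewood and Pólya, majorization is a finite chain of T-transforms, each moving
weight between only two opinions `i` and `j`. Couplings compose by gluing and majorization is
transitive, so a single T-transform of the weights suffices.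

For one such step, merge `j` into `i`. The merged assignment has the same law under both weight
vectors, since `x i + x j` is preserved. Given it, the `m` nodes of the merged class split
binomially, and the larger of the two parts is stochastically larger for the more spread-out pair of
weights (`foldedTail_le_foldedTail`). Coupling these maxima by quantiles inside each fibre
(`Coupled.of_fiber_tail_le`) leaves all other counts equal, preserves the sum of the two counts and
does not increase their maximum: the counts are themselves related by a T-transform, hence by
majorization. -/

/-! ### Couplings of discrete laws -/

namespace PMF

/-- A coupling of two laws which is supported in a relation. -/
def Coupled {α β : Type*} (R : α → β → Prop) (μ : PMF α) (ν : PMF β) : Prop :=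
  ∃ γ : PMF (α × β), γ.map Prod.fst = μ ∧ γ.map Prod.snd = ν ∧ ∀ z ∈ γ.support, R z.1 z.2

/-- The kernel is the conditional law of `μ` given `f = b`; where `b` has mass zero any law will do.
-/
theorem exists_disintegration {α β : Type*} (μ : PMF α) (f : α → β) :
    ∃ κ : β → PMF α, (μ.map f).bind κ = μ ∧
      ∀ b ∈ (μ.map f).support, ∀ a ∈ (κ b).support, f a = b := by
  classical
  have key : ∀ b, ∃ κ : PMF α, b ∈ (μ.map f).support →
      ∀ a, κ a = if f a = b then μ a * (μ.map f b)⁻¹ else 0 := by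
    intro b
    by_cases hb : b ∈ (μ.map f).support
    · have hs : ∃ a ∈ f ⁻¹' {b}, a ∈ μ.support := by
        obtain ⟨a, ha, rfl⟩ := (PMF.mem_support_map_iff f μ b).1 hb
        exact ⟨a, rfl, ha⟩
      refine ⟨μ.filter _ hs, fun _ a => ?_⟩
      rw [PMF.filter_apply, PMF.map_apply]
      have : (∑' a', (f ⁻¹' {b}).indicator μ a') = ∑' a', if b = f a' then μ a' else 0 := by
        refine tsum_congr fun a' => ?_
        simp [Set.indicator_apply, eq_comm]
      rw [this]
      by_cases h : f a = b <;> simp [h]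
    · exact ⟨μ, fun h => absurd h hb⟩
  choose κ hκ using key
  refine ⟨κ, ?_, ?_⟩
  · ext a
    rw [PMF.bind_apply, tsum_eq_single (f a)]
    · by_cases h : f a ∈ (μ.map f).support
      · rw [hκ _ h, if_pos rfl, mul_comm (μ a), ← mul_assoc, ENNReal.mul_inv_cancel, one_mul]
        · exact (PMF.mem_support_iff _ _).1 h
        · exact PMF.apply_ne_top _ _
      · have h0 : μ a = 0 := by
          by_contra ha
          exact h ((PMF.mem_support_map_iff f μ _).2 ⟨a, (PMF.mem_support_iff _ _).2 ha, rfl⟩)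
        rw [(PMF.apply_eq_zero_iff _ _).2 h, zero_mul, h0]
    · intro b hb
      by_cases h : b ∈ (μ.map f).support
      · rw [hκ _ h, if_neg (Ne.symm hb), mul_zero]
      · rw [(PMF.apply_eq_zero_iff _ _).2 h, zero_mul]
  · intro b hb a ha
    by_contra h
    rw [PMF.mem_support_iff, hκ b hb, if_neg h] at ha
    exact ha rfl

theorem bind_congr_support {α β : Type*} (μ : PMF α) {f g : α → PMF β}
    (h : ∀ a ∈ μ.support, f a = g a) : μ.bind f = μ.bind g := by
  ext b
  rw [PMF.bind_apply, PMF.bind_apply]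
  refine tsum_congr fun a => ?_
  by_cases ha : a ∈ μ.support
  · rw [h a ha]
  · rw [(PMF.apply_eq_zero_iff _ _).2 ha, zero_mul, zero_mul]

theorem eq_of_le {α : Type*} {μ ν : PMF α} (h : ∀ a, μ a ≤ ν a) : μ = ν := by
  by_contra hne
  obtain ⟨a, ha⟩ : ∃ a, μ a ≠ ν a := by
    by_contra! hc
    exact hne (PMF.ext hc)
  have := ENNReal.tsum_lt_tsum (by rw [μ.tsum_coe]; exact ENNReal.one_ne_top) h
    (lt_of_le_of_ne (h a) ha)
  rw [μ.tsum_coe, ν.tsum_coe] at this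
  exact lt_irrefl _ this

namespace Coupled

variable {α β δ ι : Type*}

theorem mono {R S : α → β → Prop} {μ : PMF α} {ν : PMF β} (h : Coupled R μ ν)
    (hRS : ∀ a b, R a b → S a b) : Coupled S μ ν := by
  obtain ⟨γ, h1, h2, h3⟩ := h
  exact ⟨γ, h1, h2, fun z hz => hRS _ _ (h3 z hz)⟩

theorem refl {R : α → α → Prop} (hR : ∀ a, R a a) (μ : PMF α) : Coupled R μ μ := by
  refine ⟨μ.map fun a => (a, a), ?_, ?_, ?_⟩
  · rw [PMF.map_comp]; exact PMF.map_id μ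
  · rw [PMF.map_comp]; exact PMF.map_id μ
  · intro z hz
    obtain ⟨a, -, rfl⟩ := (PMF.mem_support_map_iff _ _ _).1 hz
    exact hR a

/-- Gluing: draw the middle value from `ν`, then the two outer values from their conditional laws,
independently of each other. -/
theorem trans {R : α → β → Prop} {S : β → δ → Prop} {T : α → δ → Prop}
    (hT : ∀ a b c, R a b → S b c → T a c) {μ : PMF α} {ν : PMF β} {ρ : PMF δ}
    (h₁ : Coupled R μ ν) (h₂ : Coupled S ν ρ) : Coupled T μ ρ := by
  obtain ⟨γ, h1, h2, h3⟩ := h₁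
  obtain ⟨η, k1, k2, k3⟩ := h₂
  obtain ⟨κ, hκ, hκs⟩ := exists_disintegration γ Prod.snd
  obtain ⟨l, hl, hls⟩ := exists_disintegration η Prod.fst
  rw [h2] at hκ hκs
  rw [k1] at hl hls
  refine ⟨ν.bind fun b => (κ b).bind fun x => (l b).map fun y => (x.1, y.2), ?_, ?_, ?_⟩
  · simp only [PMF.map_bind, PMF.map_comp]
    rw [← h1, ← hκ, PMF.map_bind]
    refine congrArg _ (funext fun b => ?_)
    rw [← PMF.bind_pure_comp]
    refine congrArg _ (funext fun x => ?_)
    exact PMF.map_const (l b) x.1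
  · simp only [PMF.map_bind, PMF.map_comp]
    rw [← k2, ← hl, PMF.map_bind]
    refine congrArg _ (funext fun b => ?_)
    exact PMF.bind_const (κ b) ((l b).map Prod.snd)
  · intro z hz
    obtain ⟨b, hb, hz⟩ := (PMF.mem_support_bind_iff _ _ _).1 hz
    obtain ⟨x, hx, hz⟩ := (PMF.mem_support_bind_iff _ _ _).1 hz
    obtain ⟨y, hy, rfl⟩ := (PMF.mem_support_map_iff _ _ _).1 hz
    have e1 := hκs b hb x hx
    have e2 := hls b hb y hy
    have hx' : x ∈ γ.support := by
      rw [← hκ]; exact (PMF.mem_support_bind_iff _ _ _).2 ⟨b, hb, hx⟩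
    have hy' : y ∈ η.support := by
      rw [← hl]; exact (PMF.mem_support_bind_iff _ _ _).2 ⟨b, hb, hy⟩
    exact hT x.1 b y.2 (e1 ▸ h3 x hx') (e2 ▸ k3 y hy')

/-- Draw the pair of images from the given coupling, then a preimage of each from the conditional
laws. -/
theorem of_map {α' β' : Type*} {R : α' → β' → Prop} {f : α → α'} {g : β → β'} {μ : PMF α}
    {ν : PMF β} (h : Coupled R (μ.map f) (ν.map g)) : Coupled (fun a b => R (f a) (g b)) μ ν := by
  obtain ⟨γ, h1, h2, h3⟩ := h
  obtain ⟨κ, hκ, hκs⟩ := exists_disintegration μ f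
  obtain ⟨l, hl, hls⟩ := exists_disintegration ν g
  refine ⟨γ.bind fun z => (κ z.1).bind fun x => (l z.2).map fun y => (x, y), ?_, ?_, ?_⟩
  · simp only [PMF.map_bind, PMF.map_comp]
    conv_rhs => rw [← hκ, ← h1, PMF.bind_map]
    refine congrArg _ (funext fun z => ?_)
    conv_rhs => rw [Function.comp_apply, ← PMF.bind_pure (κ z.1)]
    refine congrArg _ (funext fun x => ?_)
    exact PMF.map_const (l z.2) x
  · simp only [PMF.map_bind, PMF.map_comp]
    conv_rhs => rw [← hl, ← h2, PMF.bind_map]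
    refine congrArg _ (funext fun z => ?_)
    refine (PMF.bind_const (κ z.1) ((l z.2).map id)).trans ?_
    exact PMF.map_id (l z.2)
  · intro w hw
    obtain ⟨z, hz, hw⟩ := (PMF.mem_support_bind_iff _ _ _).1 hw
    obtain ⟨x, hx, hw⟩ := (PMF.mem_support_bind_iff _ _ _).1 hw
    obtain ⟨y, hy, rfl⟩ := (PMF.mem_support_map_iff _ _ _).1 hw
    have z1 : z.1 ∈ (μ.map f).support := by
      rw [← h1]; exact (PMF.mem_support_map_iff _ _ _).2 ⟨z, hz, rfl⟩
    have z2 : z.2 ∈ (ν.map g).support := by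
      rw [← h2]; exact (PMF.mem_support_map_iff _ _ _).2 ⟨z, hz, rfl⟩
    show R (f x) (g y)
    rw [hκs _ z1 x hx, hls _ z2 y hy]
    exact h3 z hz

theorem bind {R : α → β → Prop} (ρ : PMF ι) {μ : ι → PMF α} {ν : ι → PMF β}
    (h : ∀ i ∈ ρ.support, Coupled R (μ i) (ν i)) : Coupled R (ρ.bind μ) (ρ.bind ν) := by
  have key : ∀ i, ∃ γ : PMF (α × β), i ∈ ρ.support → γ.map Prod.fst = μ i ∧
      γ.map Prod.snd = ν i ∧ ∀ z ∈ γ.support, R z.1 z.2 := by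
    intro i
    by_cases hi : i ∈ ρ.support
    · obtain ⟨γ, hγ⟩ := h i hi
      exact ⟨γ, fun _ => hγ⟩
    · exact ⟨(μ i).bind fun x => (ν i).map fun y => (x, y), fun h => absurd h hi⟩
  choose γ hγ using key
  refine ⟨ρ.bind γ, ?_, ?_, ?_⟩
  · rw [PMF.map_bind]
    exact bind_congr_support _ fun i hi => (hγ i hi).1
  · rw [PMF.map_bind]
    exact bind_congr_support _ fun i hi => (hγ i hi).2.1
  · intro z hz
    obtain ⟨i, hi, hz⟩ := (PMF.mem_support_bind_iff _ _ _).1 hz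
    exact (hγ i hi).2.2 z hz

end Coupled

/-! ### Quantile couplings -/

/-- The quantile function of a law on `ℕ`, in terms of its tails. -/
theorem exists_quantile (μ : PMF ℕ) : ∃ X : ℝ → ℕ, Measurable X ∧
    (∀ u ∈ Set.Ioo (0 : ℝ) 1, ∀ j, j ≤ X u ↔ ENNReal.ofReal u < μ.toMeasure (Set.Ici j)) ∧
      (volume.restrict (Set.Ioo (0 : ℝ) 1)).map X = μ.toMeasure := by
  classical
  set T : ℕ → ENNReal := fun j => μ.toMeasure (Set.Ici j) with hT
  have anti : Antitone T := fun i j hij => measure_mono (Set.Ici_subset_Ici.2 hij)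
  have lim : Filter.Tendsto T Filter.atTop (nhds 0) := by
    have h := tendsto_measure_iInter_atTop (μ := μ.toMeasure) (s := fun j : ℕ => Set.Ici j)
      (fun j => (MeasurableSet.of_discrete).nullMeasurableSet)
      (fun i j hij => Set.Ici_subset_Ici.2 hij) ⟨0, measure_ne_top _ _⟩
    have e : (⋂ j : ℕ, Set.Ici j) = (∅ : Set ℕ) := by
      ext x
      simp only [Set.mem_iInter, Set.mem_Ici, Set.mem_empty_iff_false, iff_false, not_forall]
      exact ⟨x + 1, by omega⟩
    rwa [e, measure_empty] at h
  have T0 : T 0 = 1 := by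
    have : (Set.Ici 0 : Set ℕ) = Set.univ := by ext; simp
    rw [hT]; simp only [this, measure_univ]
  -- The shift to `j + 1` makes `Y u` the last index whose tail exceeds `u`. For `u > 0` the set is
  -- nonempty because the tails tend to zero.
  set Y : ℝ → ℕ := fun u => sInf {j | T (j + 1) ≤ ENNReal.ofReal u} with hY
  have char : ∀ u ∈ Set.Ioo (0 : ℝ) 1, ∀ j, j ≤ Y u ↔ ENNReal.ofReal u < T j := by
    intro u hu j
    have hne : {j | T (j + 1) ≤ ENNReal.ofReal u}.Nonempty := by
      have h0 : 0 < ENNReal.ofReal u := ENNReal.ofReal_pos.2 hu.1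
      obtain ⟨j, hj⟩ := ((lim.eventually (gt_mem_nhds h0)).exists)
      exact ⟨j, (anti (Nat.le_succ j)).trans hj.le⟩
    constructor
    · intro h
      rcases j with _ | j
      · rw [T0, ENNReal.ofReal_lt_one]; exact hu.2
      · by_contra hc
        have : Y u ≤ j := Nat.sInf_le (not_lt.1 hc)
        omega
    · intro h
      by_contra hc
      have hm : T (Y u + 1) ≤ ENNReal.ofReal u := Nat.sInf_mem hne
      exact absurd ((anti (show Y u + 1 ≤ j by omega)).trans hm) (not_le.2 h)
  have meas : Measurable ((Set.Ioo (0 : ℝ) 1).indicator Y) := by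
    refine measurable_of_Ici fun j => ?_
    rcases j with _ | j
    · convert MeasurableSet.univ using 1; ext; simp
    · have : (Set.Ioo (0 : ℝ) 1).indicator Y ⁻¹' Set.Ici (j + 1) =
          Set.Ioo 0 1 ∩ {u | ENNReal.ofReal u < T (j + 1)} := by
        ext u
        by_cases hu : u ∈ Set.Ioo (0 : ℝ) 1
        · simp only [Set.mem_preimage, Set.indicator_of_mem hu, Set.mem_Ici, char u hu,
            Set.mem_inter_iff, hu, true_and, Set.mem_ofPred_eq]
        · simp [hu]
      rw [this]
      exact measurableSet_Ioo.inter (measurableSet_lt ENNReal.measurable_ofReal measurable_const)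
  have char' : ∀ u ∈ Set.Ioo (0 : ℝ) 1, ∀ j,
      j ≤ (Set.Ioo (0 : ℝ) 1).indicator Y u ↔ ENNReal.ofReal u < T j := by
    intro u hu j
    rw [Set.indicator_of_mem hu]; exact char u hu j
  refine ⟨_, meas, char', ?_⟩
  have : IsFiniteMeasure ((volume.restrict (Set.Ioo (0 : ℝ) 1)).map
      ((Set.Ioo (0 : ℝ) 1).indicator Y)) := inferInstance
  refine Measure.ext_of_Ici _ _ fun j => ?_
  rw [Measure.map_apply meas measurableSet_Ici, Measure.restrict_apply (meas measurableSet_Ici)]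
  have hTj : T j ≤ 1 := prob_le_one
  have hr : (T j).toReal ≤ 1 := by simpa using ENNReal.toReal_mono ENNReal.one_ne_top hTj
  have : (Set.Ioo (0 : ℝ) 1).indicator Y ⁻¹' Set.Ici j ∩ Set.Ioo 0 1 =
      Set.Ioo 0 (T j).toReal := by
    ext u
    constructor
    · rintro ⟨h, hu⟩
      have := (char' u hu j).1 h
      exact ⟨hu.1, (ENNReal.ofReal_lt_iff_lt_toReal hu.1.le (measure_ne_top _ _)).1 this⟩
    · rintro ⟨h0, h1⟩
      have hu : u ∈ Set.Ioo (0 : ℝ) 1 := ⟨h0, h1.trans_le hr⟩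
      exact ⟨(char' u hu j).2
        ((ENNReal.ofReal_lt_iff_lt_toReal hu.1.le (measure_ne_top _ _)).2 h1), hu⟩
  rw [this, Real.volume_Ioo, sub_zero, ENNReal.ofReal_toReal (measure_ne_top _ _)]

/-- Both quantile functions are fed the same uniform variable, and larger tails give larger
quantiles. -/
theorem Coupled.of_tail_le {μ ν : PMF ℕ}
    (h : ∀ j, ν.toMeasure (Set.Ici j) ≤ μ.toMeasure (Set.Ici j)) :
    Coupled (fun a b => b ≤ a) μ ν := by
  obtain ⟨X, mX, cX, lX⟩ := exists_quantile μ
  obtain ⟨Y, mY, cY, lY⟩ := exists_quantile ν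
  set U : Measure ℝ := volume.restrict (Set.Ioo (0 : ℝ) 1) with hU
  have : IsProbabilityMeasure U := ⟨by simp [hU]⟩
  have mXY : Measurable fun u => (X u, Y u) := mX.prodMk mY
  have : IsProbabilityMeasure (U.map fun u => (X u, Y u)) :=
    Measure.isProbabilityMeasure_map mXY.aemeasurable
  refine ⟨(U.map fun u => (X u, Y u)).toPMF, ?_, ?_, ?_⟩
  · rw [← PMF.toMeasure_inj, ← PMF.toMeasure_map _ _ measurable_fst, Measure.toPMF_toMeasure,
      Measure.map_map measurable_fst mXY]
    exact lX
  · rw [← PMF.toMeasure_inj, ← PMF.toMeasure_map _ _ measurable_snd, Measure.toPMF_toMeasure,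
      Measure.map_map measurable_snd mXY]
    exact lY
  · intro z hz
    by_contra hc
    rw [PMF.mem_support_iff, Measure.toPMF_apply, Measure.map_apply mXY .of_discrete] at hz
    apply hz
    rw [hU, Measure.restrict_apply (mXY .of_discrete)]
    convert measure_empty (μ := (volume : Measure ℝ)) using 2
    ext u
    simp only [Set.mem_inter_iff, Set.mem_preimage, Set.mem_singleton_iff, Set.mem_empty_iff_false,
      iff_false, not_and]
    rintro rfl hu
    exact hc ((cX u hu _).2 (((cY u hu _).1 le_rfl).trans_le (h _)))

/-- The case `j = 0` forces `f` to have the same law under `μ` and `ν`. Dividing by the mass of a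
fibre turns the hypothesis into tail domination of `g` under the conditional laws, which are coupled
fibre by fibre and mixed. -/
theorem Coupled.of_fiber_tail_le {α B : Type*} {μ ν : PMF α} (f : α → B) (g : α → ℕ)
    (h : ∀ b j, ν.toOuterMeasure {a | f a = b ∧ j ≤ g a} ≤
      μ.toOuterMeasure {a | f a = b ∧ j ≤ g a}) :
    Coupled (fun x y => f x = f y ∧ g y ≤ g x) μ ν := by
  have hf : μ.map f = ν.map f := by
    refine (eq_of_le fun b => ?_).symm
    rw [← PMF.toOuterMeasure_apply_singleton, ← PMF.toOuterMeasure_apply_singleton,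
      PMF.toOuterMeasure_map_apply, PMF.toOuterMeasure_map_apply]
    have := h b 0
    simp only [Nat.zero_le, and_true] at this
    exact this
  obtain ⟨κ, hκ, hκs⟩ := exists_disintegration μ f
  obtain ⟨l, hl, hls⟩ := exists_disintegration ν f
  rw [← hf] at hl hls
  have tail : ∀ (ξ : PMF α) (k : B → PMF α) (ρ : PMF B), ρ.bind k = ξ →
      (∀ b ∈ ρ.support, ∀ a ∈ (k b).support, f a = b) → ∀ b ∈ ρ.support, ∀ j,
      ξ.toOuterMeasure {a | f a = b ∧ j ≤ g a} =
        ρ b * ((k b).map g).toMeasure (Set.Ici j) := by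
    intro ξ k ρ hk hks b hb j
    rw [← hk, PMF.toOuterMeasure_bind_apply, tsum_eq_single b]
    · rw [PMF.toMeasure_apply_eq_toOuterMeasure_apply _ .of_discrete,
        PMF.toOuterMeasure_map_apply]
      congr 1
      refine PMF.toOuterMeasure_apply_eq_of_inter_support_eq _ ?_
      ext a
      simp only [Set.mem_inter_iff, Set.mem_ofPred_eq, Set.mem_preimage, Set.mem_Ici]
      constructor
      · rintro ⟨⟨-, h⟩, h'⟩; exact ⟨h, h'⟩
      · rintro ⟨h, h'⟩; exact ⟨⟨hks b hb a h', h⟩, h'⟩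
    · intro b' hb'
      by_cases hs : b' ∈ ρ.support
      · rw [(PMF.toOuterMeasure_apply_eq_zero_iff _ _).2, mul_zero]
        rw [Set.disjoint_left]
        rintro a ha ⟨rfl, -⟩
        exact hb' (hks b' hs a ha).symm
      · rw [(PMF.apply_eq_zero_iff _ _).2 hs, zero_mul]
  have := Coupled.bind (R := fun x y => f x = f y ∧ g y ≤ g x) (μ.map f) (μ := κ) (ν := l) ?_
  · rwa [hκ, hl] at this
  intro b hb
  have hc : Coupled (fun x y => g y ≤ g x) (κ b) (l b) := by
    refine Coupled.of_map (R := fun x y : ℕ => y ≤ x) (Coupled.of_tail_le fun j => ?_)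
    have := h b j
    rw [tail μ κ _ hκ hκs b hb, tail ν l _ hl hls b hb] at this
    exact (ENNReal.mul_le_mul_iff_right ((PMF.mem_support_iff _ _).1 hb)
      (PMF.apply_ne_top _ _)).1 this
  obtain ⟨γ, h1, h2, h3⟩ := hc
  refine ⟨γ, h1, h2, fun z hz => ⟨?_, h3 z hz⟩⟩
  rw [hκs b hb z.1 (by rw [← h1]; exact (PMF.mem_support_map_iff _ _ _).2 ⟨z, hz, rfl⟩),
    hls b hb z.2 (by rw [← h2]; exact (PMF.mem_support_map_iff _ _ _).2 ⟨z, hz, rfl⟩)]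

end PMF

/-! ### T-transforms and majorization -/

/-- `TTransform x y`: the vector `y` arises from `x` by averaging `x` with its image under a
transposition. -/
def TTransform {ι : Type*} [DecidableEq ι] (x y : ι → ℝ) : Prop :=
  ∃ i j : ι, ∃ s : ℝ, 0 ≤ s ∧ s ≤ 1 ∧ ∀ v, y v = (1 - s) * x v + s * x (Equiv.swap i j v)

theorem TTransform.sum_eq {ι : Type*} [DecidableEq ι] [Fintype ι] {x y : ι → ℝ}
    (h : TTransform x y) : ∑ v, x v = ∑ v, y v := by
  obtain ⟨i, j, s, -, -, h⟩ := h
  simp only [h, Finset.sum_add_distrib, ← Finset.mul_sum, Equiv.sum_comp (Equiv.swap i j) x]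
  ring

theorem TTransform.nonneg {ι : Type*} [DecidableEq ι] {x y : ι → ℝ}
    (h : TTransform x y) (hx : ∀ v, 0 ≤ x v) (v : ι) : 0 ≤ y v := by
  obtain ⟨i, j, s, h0, h1, h⟩ := h
  rw [h]
  exact add_nonneg (mul_nonneg (by linarith) (hx _)) (mul_nonneg h0 (hx _))

/-- A transfer between two coordinates that does not increase the larger one is a T-transform. -/
theorem TTransform.of_transfer {ι : Type*} [DecidableEq ι] {x y : ι → ℝ} {i j : ι} (hij : i ≠ j)
    (h : ∀ v, v ≠ i → v ≠ j → y v = x v) (hs : y i + y j = x i + x j)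
    (hm : max (y i) (y j) ≤ max (x i) (x j)) : TTransform x y := by
  -- An equal sum and no larger maximum confine `c` and `d` to the segment between `a` and `b`; `s`
  -- is the relative position of `c` on it.
  have key : ∀ a b c d : ℝ, c + d = a + b → max c d ≤ max a b →
      ∃ s : ℝ, 0 ≤ s ∧ s ≤ 1 ∧ c = (1 - s) * a + s * b ∧ d = (1 - s) * b + s * a := by
    intro a b c d hs hm
    have hc : c ≤ max a b := (le_max_left _ _).trans hm
    have hd : d ≤ max a b := (le_max_right _ _).trans hm
    rcases lt_trichotomy a b with hab | hab | hab
    · rw [max_eq_right hab.le] at hc hd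
      have hp : 0 < b - a := by linarith
      refine ⟨(c - a) / (b - a), by apply div_nonneg <;> linarith, ?_, ?_, ?_⟩
      · rw [div_le_one hp]; linarith
      · field_simp; ring
      · rw [show d = a + b - c by linarith]; field_simp; ring
    · subst hab
      rw [max_self] at hc hd
      exact ⟨0, le_rfl, zero_le_one, by linarith, by linarith⟩
    · rw [max_eq_left hab.le] at hc hd
      have hp : 0 < a - b := by linarith
      refine ⟨(a - c) / (a - b), by apply div_nonneg <;> linarith, ?_, ?_, ?_⟩
      · rw [div_le_one hp]; linarith
      · field_simp; ring
      · rw [show d = a + b - c by linarith]; field_simp; ring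
  obtain ⟨s, h0, h1, e1, e2⟩ := key _ _ _ _ hs hm
  refine ⟨i, j, s, h0, h1, fun v => ?_⟩
  by_cases hi : v = i
  · subst hi; rw [Equiv.swap_apply_left, e1]
  by_cases hj : v = j
  · subst hj; rw [Equiv.swap_apply_right, e2]
  rw [Equiv.swap_apply_of_ne_of_ne hi hj, h v hi hj]; ring

/-- Exchange argument: off the intersection both sets have equally many elements, with values at
most `f l` in `t` and at least `f l` in the initial segment. -/
theorem sum_le_sum_Iic_of_antitone {d : ℕ} {f : Fin d → ℝ} (hf : Antitone f) (l : Fin d)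
    (t : Finset (Fin d)) (ht : t.card = l.val + 1) : ∑ i ∈ t, f i ≤ ∑ i ∈ Finset.Iic l, f i := by
  have hc : (t \ Finset.Iic l).card = (Finset.Iic l \ t).card := by
    have h1 := Finset.card_sdiff_add_card_inter t (Finset.Iic l)
    have h2 := Finset.card_sdiff_add_card_inter (Finset.Iic l) t
    rw [Finset.inter_comm] at h2
    have h3 : (Finset.Iic l).card = l.val + 1 := Fin.card_Iic l
    omega
  rw [← Finset.sum_inter_add_sum_sdiff t (Finset.Iic l) f,
    ← Finset.sum_inter_add_sum_sdiff (Finset.Iic l) t f, Finset.inter_comm]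
  refine add_le_add le_rfl ?_
  calc ∑ i ∈ t \ Finset.Iic l, f i ≤ (t \ Finset.Iic l).card • f l := by
        refine Finset.sum_le_card_nsmul _ _ _ fun i hi => hf ?_
        simp only [Finset.mem_sdiff, Finset.mem_Iic, not_le] at hi
        exact hi.2.le
    _ = (Finset.Iic l \ t).card • f l := by rw [hc]
    _ ≤ ∑ i ∈ Finset.Iic l \ t, f i := by
        refine Finset.card_nsmul_le_sum _ _ _ fun i hi => hf ?_
        simp only [Finset.mem_sdiff, Finset.mem_Iic] at hi
        exact hi.1

/-- With `exists_sum_eq_sum_sortDown`, this expresses the top sums as maxima over index sets of size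
`l + 1`, so that sorting need not be tracked. -/
theorem sum_le_sum_sortDown {d : ℕ} (x : Fin d → ℝ) (l : Fin d) (t : Finset (Fin d))
    (ht : t.card = l.val + 1) : ∑ i ∈ t, x i ≤ ∑ i ∈ Finset.Iic l, sortDown x i := by
  set σ := Tuple.sort (fun i => -x i) with hσ
  have h := sum_le_sum_Iic_of_antitone (sortDown_antitone x) l (t.map σ.symm.toEmbedding)
    (by rw [Finset.card_map, ht])
  rw [Finset.sum_map] at h
  simpa [sortDown, ← hσ] using h

theorem exists_sum_eq_sum_sortDown {d : ℕ} (x : Fin d → ℝ) (l : Fin d) :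
    ∃ t : Finset (Fin d), t.card = l.val + 1 ∧
      ∑ i ∈ Finset.Iic l, sortDown x i = ∑ i ∈ t, x i := by
  refine ⟨(Finset.Iic l).map (Tuple.sort (fun i => -x i)).toEmbedding, ?_, ?_⟩
  · rw [Finset.card_map, Fin.card_Iic]
  · rw [Finset.sum_map]; rfl

theorem Majorizes.refl {d : ℕ} (x : Fin d → ℝ) : Majorizes x x := ⟨fun _ => le_rfl, rfl⟩

theorem Majorizes.trans {d : ℕ} {x y z : Fin d → ℝ} (h : Majorizes x y) (k : Majorizes y z) :
    Majorizes x z :=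
  ⟨fun l => (k.1 l).trans (h.1 l), h.2.trans k.2⟩

/-- On an optimal index set `t` for `y`, the sum of `y` is a convex combination of the sums of `x`
over `t` and over its swapped image, both bounded by the top sum of `x`. -/
theorem TTransform.majorizes {d : ℕ} {x y : Fin d → ℝ} (h : TTransform x y) : Majorizes x y := by
  refine ⟨fun l => ?_, h.sum_eq⟩
  obtain ⟨t, ht, e⟩ := exists_sum_eq_sum_sortDown y l
  obtain ⟨i, j, s, h0, h1, h⟩ := h
  have a1 := sum_le_sum_sortDown x l t ht
  have a2 := sum_le_sum_sortDown x l (t.map (Equiv.swap i j).toEmbedding)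
    (by rw [Finset.card_map, ht])
  rw [Finset.sum_map] at a2
  rw [e]
  simp only [h, Finset.sum_add_distrib, ← Finset.mul_sum]
  have b1 := mul_le_mul_of_nonneg_left a1 (show 0 ≤ 1 - s by linarith)
  have b2 := mul_le_mul_of_nonneg_left a2 h0
  simp only [Equiv.coe_toEmbedding] at b2
  linarith

/-- A transposition is the T-transform with `s = 1`, and transpositions generate the permutations.
-/
theorem reflTransGen_tTransform_comp_perm {ι : Type*} [DecidableEq ι] [Finite ι]
    (σ : Equiv.Perm ι) : ∀ x : ι → ℝ, Relation.ReflTransGen TTransform x (x ∘ σ) := by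
  refine Equiv.Perm.swap_induction_on σ (fun x => Relation.ReflTransGen.refl) ?_
  intro f i j _ ih x
  refine Relation.ReflTransGen.head (b := x ∘ Equiv.swap i j) ?_ (ih _)
  exact ⟨i, j, 1, zero_le_one, le_rfl, fun v => by simp⟩

/-- Vectors whose partial sums dominate those of an antitone vector `y` can be turned into `y` by
T-transforms. -/
theorem reflTransGen_tTransform_of_antitone {d : ℕ} {y : Fin d → ℝ} (hy : Antitone y) :
    ∀ x : Fin d → ℝ, (∀ l, ∑ i ∈ Finset.Iic l, y i ≤ ∑ i ∈ Finset.Iic l, x i) →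
      ∑ i, x i = ∑ i, y i → Relation.ReflTransGen TTransform x y := by
  -- Induction on the number of coordinates in which `x` and `y` differ.
  have main : ∀ N : ℕ, ∀ x : Fin d → ℝ, (Finset.univ.filter fun i => x i ≠ y i).card ≤ N →
      (∀ l, ∑ i ∈ Finset.Iic l, y i ≤ ∑ i ∈ Finset.Iic l, x i) →
      ∑ i, x i = ∑ i, y i → Relation.ReflTransGen TTransform x y := by
    intro N
    induction N with
    | zero =>
      intro x hN _ _
      have : x = y := by
        funext i
        by_contra h
        have hi : i ∈ Finset.univ.filter fun i => x i ≠ y i := by simpa using h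
        have := Finset.card_pos.2 ⟨i, hi⟩
        omega
      rw [this]
    | succ N ih =>
      intro x hN hpre hsum
      by_cases hxy : x = y
      · rw [hxy]
      have hneg : ∃ k, x k < y k := by
        by_contra! hc
        apply hxy
        have := (Finset.sum_eq_sum_iff_of_le (s := Finset.univ) fun i _ => hc i).1 hsum.symm
        funext i
        exact (this i (Finset.mem_univ i)).symm
      -- `k` is the first deficient coordinate; prefix dominance at `k` then yields an earlier
      -- coordinate `j` with a surplus. Moving the smaller of surplus and deficit from `j` to `k`
      -- settles at least one of the two.
      obtain ⟨k, hk, hmin⟩ : ∃ k, x k < y k ∧ ∀ i, i < k → y i ≤ x i := by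
        have hne : (Finset.univ.filter fun i => x i < y i).Nonempty := by
          obtain ⟨k, hk⟩ := hneg
          exact ⟨k, by simpa using hk⟩
        refine ⟨_, (Finset.mem_filter.1 (Finset.min'_mem _ hne)).2, fun i hi => ?_⟩
        by_contra! hc
        exact absurd (Finset.min'_le _ i (by simpa using hc)) (not_le.2 hi)
      obtain ⟨j, hjk, hj⟩ : ∃ j, j < k ∧ y j < x j := by
        by_contra! hc
        refine absurd (hpre k) (not_le.2 (Finset.sum_lt_sum (fun i hi => ?_)
          ⟨k, Finset.mem_Iic.2 le_rfl, hk⟩))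
        rcases (Finset.mem_Iic.1 hi).eq_or_lt with rfl | h
        · exact hk.le
        · exact hc i h
      set δ := min (x j - y j) (y k - x k) with hδ
      have δ1 : δ ≤ x j - y j := min_le_left _ _
      have δ2 : δ ≤ y k - x k := min_le_right _ _
      have δ0 : 0 < δ := lt_min (by linarith) (by linarith)
      have hjk' := hy hjk.le
      set z : Fin d → ℝ := fun i => x i + ((if i = k then δ else 0) - (if i = j then δ else 0))
        with hz
      have zj : z j = x j - δ := by simp [hz, hjk.ne]; ring
      have zk : z k = x k + δ := by simp [hz, hjk.ne']
      have zo : ∀ i, i ≠ j → i ≠ k → z i = x i := by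
        intro i h1 h2; simp [hz, h1, h2]
      have hT : TTransform x z := by
        refine TTransform.of_transfer hjk.ne zo (by rw [zj, zk]; ring) ?_
        rw [zj, zk]
        -- Here `x k + δ ≤ y k ≤ y j < x j`.
        refine le_max_of_le_left (max_le ?_ ?_) <;> linarith
      refine Relation.ReflTransGen.head hT (ih z ?_ ?_ ?_)
      · have hsub : (Finset.univ.filter fun i => z i ≠ y i) ⊂
            Finset.univ.filter fun i => x i ≠ y i := by
          refine Finset.ssubset_iff_subset_ne.2 ⟨?_, ?_⟩
          · intro i hi
            simp only [Finset.mem_filter, Finset.mem_univ, true_and] at hi ⊢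
            by_cases h1 : i = j
            · subst h1; exact hj.ne'
            by_cases h2 : i = k
            · subst h2; exact hk.ne
            rwa [zo i h1 h2] at hi
          · intro he
            rcases min_choice (x j - y j) (y k - x k) with h | h
            · have : j ∈ Finset.univ.filter fun i => z i ≠ y i := by
                rw [he]; simpa using hj.ne'
              simp only [Finset.mem_filter, Finset.mem_univ, true_and] at this
              exact this (by rw [zj, hδ, h]; ring)
            · have : k ∈ Finset.univ.filter fun i => z i ≠ y i := by
                rw [he]; simpa using hk.ne
              simp only [Finset.mem_filter, Finset.mem_univ, true_and] at this
              exact this (by rw [zk, hδ, h]; ring)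
        have := Finset.card_lt_card hsub
        omega
      · intro l
        have hsz : ∑ i ∈ Finset.Iic l, z i = ∑ i ∈ Finset.Iic l, x i +
            ((if k ≤ l then δ else 0) - if j ≤ l then δ else 0) := by
          simp only [hz, Finset.sum_add_distrib, Finset.sum_sub_distrib, Finset.sum_ite_eq',
            Finset.mem_Iic]
        rw [hsz]
        by_cases h1 : j ≤ l
        · by_cases h2 : k ≤ l
          · simp only [h1, h2, if_true, sub_self, add_zero]; exact hpre l
          · simp only [h1, h2, if_true, if_false]
            -- Only prefixes containing `j` but not `k` lose weight. By minimality of `k` all their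
            -- excesses are nonnegative, so the total is at least the surplus at `j`, hence at least
            -- `δ`.
            have : x j - y j ≤ ∑ i ∈ Finset.Iic l, (x i - y i) := by
              refine Finset.single_le_sum (f := fun i => x i - y i) (fun i hi => ?_)
                (Finset.mem_Iic.2 h1)
              have := hmin i ((Finset.mem_Iic.1 hi).trans_lt (not_le.1 h2))
              linarith
            rw [Finset.sum_sub_distrib] at this
            linarith
        · have h2 : ¬ k ≤ l := fun h => h1 (hjk.le.trans h)
          simp only [h1, h2, if_false, sub_self, add_zero]; exact hpre l
      · rw [← hT.sum_eq]; exact hsum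
  exact fun x => main _ x le_rfl

/-- The Hardy–Littlewood–Pólya theorem in terms of T-transforms. -/
theorem Majorizes.reflTransGen_tTransform {d : ℕ} {x y : Fin d → ℝ} (h : Majorizes x y) :
    Relation.ReflTransGen TTransform x y := by
  have sum_sort : ∀ z : Fin d → ℝ, ∑ i, sortDown z i = ∑ i, z i := fun z =>
    Equiv.sum_comp (Tuple.sort fun i => -z i) z
  have h1 : Relation.ReflTransGen TTransform x (sortDown x) :=
    reflTransGen_tTransform_comp_perm _ x
  have h2 : Relation.ReflTransGen TTransform (sortDown x) (sortDown y) :=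
    reflTransGen_tTransform_of_antitone (sortDown_antitone y) _ h.1
      (by rw [sum_sort, sum_sort, h.2])
  have h3 : Relation.ReflTransGen TTransform (sortDown y) y := by
    convert reflTransGen_tTransform_comp_perm (Tuple.sort fun i => -y i).symm (sortDown y) using 1
    funext i
    simp [sortDown]
  exact h1.trans (h2.trans h3)

/-! ### Tails of the larger count of a binomial split -/

/-- The `a`-th summand has derivative `D a - D (a + 1)`, so the sum telescopes to its lower boundary
term; `D (m + 1)` vanishes. -/
theorem hasDerivAt_sum_choose_mul (m r : ℕ) (h u : ℝ) :
    HasDerivAt (fun u : ℝ => ∑ a ∈ Finset.Ico r (m + 1),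
      (m.choose a : ℝ) * ((h + u) ^ a * (h - u) ^ (m - a)))
      (r * m.choose r * ((h + u) ^ (r - 1) * (h - u) ^ (m - r))) u := by
  set D : ℕ → ℝ := fun a => a * m.choose a * ((h + u) ^ (a - 1) * (h - u) ^ (m - a)) with hD
  have term : ∀ a ∈ Finset.Ico r (m + 1), HasDerivAt
      (fun u : ℝ => (m.choose a : ℝ) * ((h + u) ^ a * (h - u) ^ (m - a))) (D a - D (a + 1)) u := by
    intro a ha
    have h1 : HasDerivAt (fun u : ℝ => (h + u) ^ a) (a * (h + u) ^ (a - 1) * 1) u :=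
      ((hasDerivAt_id u).const_add h).pow a
    have h2 : HasDerivAt (fun u : ℝ => (h - u) ^ (m - a))
        ((m - a : ℕ) * (h - u) ^ (m - a - 1) * (-1)) u :=
      ((hasDerivAt_id u).const_sub h).pow (m - a)
    refine ((h1.mul h2).const_mul (m.choose a : ℝ)).congr_deriv ?_
    have hc : ((a + 1 : ℕ) : ℝ) * m.choose (a + 1) = m.choose a * (m - a : ℕ) := by
      have := Nat.choose_succ_right_eq m a
      rw [mul_comm]; exact_mod_cast this
    simp only [hD]
    rw [hc, Nat.add_sub_cancel, ← Nat.sub_sub]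
    ring
  have hs := HasDerivAt.fun_sum term
  refine hs.congr_deriv ?_
  change _ = D r
  rcases le_or_gt r (m + 1) with hrm | hrm
  · rw [Finset.sum_Ico_eq_sum_range]
    refine (Finset.sum_range_sub' (fun a => D (r + a)) _).trans ?_
    have : D (m + 1) = 0 := by simp [hD]
    rw [Nat.add_sub_cancel' hrm, this]; simp
  · rw [Finset.Ico_eq_empty (by omega), Finset.sum_empty]
    simp [hD, Nat.choose_eq_zero_of_lt (show m < r by omega)]

/-- The weight of the outcomes of a homogeneous binomial law in which one of the two counts is at
least `r`. -/
noncomputable def foldedTail (m r : ℕ) (x y : ℝ) : ℝ :=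
  ∑ a ∈ Finset.range (m + 1), if r ≤ max a (m - a) then
    (m.choose a : ℝ) * (x ^ a * y ^ (m - a)) else 0

theorem foldedTail_of_two_mul_le {m r : ℕ} (h : 2 * r ≤ m) (x y : ℝ) :
    foldedTail m r x y = (x + y) ^ m := by
  rw [add_pow, foldedTail]
  refine Finset.sum_congr rfl fun a ha => ?_
  rw [Finset.mem_range] at ha
  rw [if_pos (by rw [le_max_iff]; omega)]
  ring

/-- For `m < 2 * r` the two counts cannot both reach `r`, so the event is a disjoint union;
reflecting `a` to `m - a` gives the second sum. -/
theorem foldedTail_of_lt_two_mul {m r : ℕ} (h : m < 2 * r) (x y : ℝ) :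
    foldedTail m r x y =
      ∑ a ∈ Finset.Ico r (m + 1), (m.choose a : ℝ) * (x ^ a * y ^ (m - a)) +
      ∑ a ∈ Finset.Ico r (m + 1), (m.choose a : ℝ) * (y ^ a * x ^ (m - a)) := by
  have hI : ∀ f : ℕ → ℝ, ∑ a ∈ Finset.Ico r (m + 1), f a =
      ∑ a ∈ Finset.range (m + 1), if r ≤ a then f a else 0 := by
    intro f
    rw [← Finset.sum_filter]
    refine Finset.sum_congr ?_ fun _ _ => rfl
    ext a; simp only [Finset.mem_Ico, Finset.mem_filter, Finset.mem_range]; tauto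
  rw [hI, hI, ← Finset.sum_flip (fun a => if r ≤ a then
    (m.choose a : ℝ) * (y ^ a * x ^ (m - a)) else 0), ← Finset.sum_add_distrib, foldedTail]
  refine Finset.sum_congr rfl fun a ha => ?_
  rw [Finset.mem_range, Nat.lt_succ_iff] at ha
  rw [Nat.choose_symm ha, Nat.sub_sub_self ha]
  by_cases h1 : r ≤ a
  · rw [if_pos (le_max_of_le_left h1), if_pos h1, if_neg (by omega), add_zero]
  · by_cases h2 : r ≤ m - a
    · rw [if_pos (le_max_of_le_right h2), if_neg h1, if_pos h2]; ring
    · rw [if_neg (by rw [le_max_iff]; tauto), if_neg h1, if_neg h2, add_zero]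

theorem foldedTail_comm (m r : ℕ) (x y : ℝ) : foldedTail m r x y = foldedTail m r y x := by
  rcases le_or_gt (2 * r) m with h | h
  · rw [foldedTail_of_two_mul_le h, foldedTail_of_two_mul_le h, add_comm]
  · rw [foldedTail_of_lt_two_mul h, foldedTail_of_lt_two_mul h, add_comm]

/-- If `2 * r ≤ m` the function is constant. Otherwise the two tails are mirror images under `u ↦
-u`, so the derivative is `D u - D (-u)`, which is nonnegative by comparing exponents. -/
theorem foldedTail_monotoneOn (m r : ℕ) (h : ℝ) :
    MonotoneOn (fun u => foldedTail m r (h + u) (h - u)) (Set.Icc 0 h) := by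
  rcases le_or_gt (2 * r) m with hr | hr
  · intro u _ v _ _
    simp only [foldedTail_of_two_mul_le hr]
    rw [show h + u + (h - u) = h + v + (h - v) by ring]
  set D : ℝ → ℝ := fun u => r * m.choose r * ((h + u) ^ (r - 1) * (h - u) ^ (m - r)) with hD
  have hd : ∀ u, HasDerivAt (fun u => foldedTail m r (h + u) (h - u)) (D u - D (-u)) u := by
    intro u
    simp only [foldedTail_of_lt_two_mul hr]
    have h1 := hasDerivAt_sum_choose_mul m r h u
    have h2 := (hasDerivAt_sum_choose_mul m r h (-u)).comp u (hasDerivAt_neg u)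
    have e := (h1.add h2).congr_deriv (show _ = D u - D (-u) by simp only [hD]; ring)
    refine e.congr_of_eventuallyEq (Filter.Eventually.of_forall fun v => ?_)
    simp [← sub_eq_add_neg]
  refine monotoneOn_of_deriv_nonneg (convex_Icc 0 h)
    (fun u _ => (hd u).continuousAt.continuousWithinAt)
    (fun u _ => (hd u).differentiableAt.differentiableWithinAt) fun u hu => ?_
  rw [interior_Icc] at hu
  rw [(hd u).deriv, sub_nonneg]
  rcases lt_or_ge m r with hm | hm
  · simp [hD, Nat.choose_eq_zero_of_lt hm]
  -- Since `m < 2 * r`, the exponent `r - 1` is at least `m - r`. After cancelling common powers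
  -- there remains `(h - u) ^ e ≤ (h + u) ^ e`.
  obtain ⟨e, he⟩ : ∃ e, r - 1 = (m - r) + e := ⟨r - 1 - (m - r), by omega⟩
  have p1 : 0 ≤ h - u := by linarith [hu.2]
  have p2 : 0 ≤ h + u := by linarith [hu.1, hu.2]
  have p3 : (h - u) ^ e ≤ (h + u) ^ e := pow_le_pow_left₀ p1 (by linarith [hu.1]) e
  simp only [hD, he]
  refine mul_le_mul_of_nonneg_left ?_ (by positivity)
  calc (h + -u) ^ (m - r + e) * (h - -u) ^ (m - r)
      = ((h - u) ^ (m - r) * (h + u) ^ (m - r)) * (h - u) ^ e := by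
        rw [sub_neg_eq_add, ← sub_eq_add_neg, pow_add]; ring
    _ ≤ ((h - u) ^ (m - r) * (h + u) ^ (m - r)) * (h + u) ^ e :=
        mul_le_mul_of_nonneg_left p3 (by positivity)
    _ = (h + u) ^ (m - r + e) * (h - u) ^ (m - r) := by rw [pow_add]; ring

theorem foldedTail_le_foldedTail (m r : ℕ) {x y x' y' : ℝ} (hx : 0 ≤ x) (hy : 0 ≤ y)
    (hs : x' + y' = x + y) (hm : max x' y' ≤ max x y) :
    foldedTail m r x' y' ≤ foldedTail m r x y := by
  have sorted : ∀ {x y x' y' : ℝ}, 0 ≤ y → y' ≤ x' → x' + y' = x + y → x' ≤ x →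
      foldedTail m r x' y' ≤ foldedTail m r x y := by
    intro x y x' y' hy hxy hs hm
    have := foldedTail_monotoneOn m r ((x + y) / 2) (a := (x' - y') / 2) (b := (x - y) / 2)
      ⟨by linarith, by linarith⟩ ⟨by linarith, by linarith⟩ (by linarith)
    simp only at this
    rwa [show (x + y) / 2 + (x' - y') / 2 = x' by linarith,
      show (x + y) / 2 - (x' - y') / 2 = y' by linarith,
      show (x + y) / 2 + (x - y) / 2 = x by ring,
      show (x + y) / 2 - (x - y) / 2 = y by ring] at this
  rcases le_total y x with h | h <;> rcases le_total y' x' with h' | h'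
  · rw [max_eq_left h, max_eq_left h'] at hm
    exact sorted hy h' hs hm
  · rw [max_eq_left h, max_eq_right h'] at hm
    rw [foldedTail_comm m r x' y']
    exact sorted hy h' (by linarith) hm
  · rw [max_eq_right h, max_eq_left h'] at hm
    rw [foldedTail_comm m r x y]
    exact sorted hx h' (by linarith) hm
  · rw [max_eq_right h, max_eq_right h'] at hm
    rw [foldedTail_comm m r x y, foldedTail_comm m r x' y']
    exact sorted hx h' (by linarith) hm

/-! ### Merging two opinions -/

section Counts

variable {V ι : Type*} [Fintype V] [DecidableEq ι]

/-- The number of nodes that hold each opinion. -/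
def counts (ω : V → ι) (i : ι) : ℕ := (Finset.univ.filter fun v => ω v = i).card

/-- The assignment in which opinion `j` is replaced by opinion `i`. -/
def collapse (i j : ι) (ω : V → ι) : V → ι := fun v => if ω v = j then i else ω v

theorem counts_collapse_add {i j : ι} (hij : i ≠ j) (ω : V → ι) :
    counts ω i + counts ω j = counts (collapse i j ω) i := by
  classical
  rw [counts, counts, counts, ← Finset.card_union_of_disjoint]
  · congr 1
    ext v
    simp only [collapse, Finset.mem_union, Finset.mem_filter, Finset.mem_univ, true_and]
    by_cases h : ω v = j <;> simp [h]
  · rw [Finset.disjoint_filter]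
    rintro v - h rfl
    exact hij h.symm

theorem counts_collapse_of_ne {i j a : ι} (hi : a ≠ i) (hj : a ≠ j) (ω : V → ι) :
    counts (collapse i j ω) a = counts ω a := by
  rw [counts, counts]
  congr 1
  ext v
  simp only [Finset.mem_filter, Finset.mem_univ, true_and]
  rw [collapse]
  by_cases h : ω v = j
  · simp [h, hi.symm, hj.symm]
  · simp [h]

/-- An assignment in the fibre over `b` amounts to the set `A` of nodes with `b v = i` that really
hold `i`, the rest holding `j`. Its weight depends only on the size of `A`, up to the common factor
of the other nodes. -/
theorem sum_filter_collapse_prod [Fintype ι] {i j : ι} (hij : i ≠ j) {b : V → ι}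
    (hb : ∀ v, b v ≠ j) (r : ℕ) (x : ι → ℝ) [DecidableEq V] :
    (∑ ω : V → ι, if collapse i j ω = b ∧ r ≤ max (counts ω i) (counts ω j) then
      ∏ v, x (ω v) else 0) =
      (∏ v with b v ≠ i, x (b v)) * foldedTail (counts b i) r (x i) (x j) := by
  set S : Finset V := Finset.univ.filter fun v => b v = i with hS
  have hf : foldedTail (counts b i) r (x i) (x j) = ∑ A ∈ S.powerset,
      if r ≤ max A.card (S.card - A.card) then x i ^ A.card * x j ^ (S.card - A.card) else 0 := by
    rw [Finset.sum_powerset_apply_card (fun a => if r ≤ max a (S.card - a) then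
      x i ^ a * x j ^ (S.card - a) else 0), foldedTail]
    refine Finset.sum_congr rfl fun a _ => ?_
    simp only [counts, ← hS, nsmul_eq_mul, mul_ite, mul_zero]
  rw [hf, Finset.mul_sum]
  simp only [mul_ite, mul_zero]
  rw [← Finset.sum_filter, ← Finset.sum_filter]
  have hcS : ∀ ω : V → ι, collapse i j ω = b → counts ω j = S.card - counts ω i := by
    intro ω h
    have := counts_collapse_add hij ω
    rw [h] at this
    change _ = S.card at this
    omega
  refine Finset.sum_bij' (fun ω _ => Finset.univ.filter fun v => ω v = i)
    (fun A _ v => if b v = i then if v ∈ A then i else j else b v) ?_ ?_ ?_ ?_ ?_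
  · intro ω hω
    simp only [Finset.mem_filter, Finset.mem_univ, true_and, Finset.mem_powerset] at hω ⊢
    refine ⟨?_, ?_⟩
    · intro v hv
      simp only [hS, Finset.mem_filter, Finset.mem_univ, true_and] at hv ⊢
      rw [← hω.1, collapse, hv, if_neg hij]
    · have := hω.2
      rwa [hcS ω hω.1] at this
  · intro A hA
    simp only [Finset.mem_filter, Finset.mem_univ, true_and, Finset.mem_powerset] at hA ⊢
    have hc : collapse i j (fun v => if b v = i then if v ∈ A then i else j else b v) = b := by
      funext v
      simp only [collapse]
      by_cases h : b v = i
      · by_cases hv : v ∈ A <;> simp [h, hv]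
      · simp [h, hb v]
    refine ⟨hc, ?_⟩
    rw [hcS _ hc]
    have : counts (fun v => if b v = i then if v ∈ A then i else j else b v) i = A.card := by
      rw [counts]
      congr 1
      ext v
      simp only [Finset.mem_filter, Finset.mem_univ, true_and]
      by_cases h : b v = i
      · by_cases hv : v ∈ A <;> simp [h, hv, hij.symm]
      · have : v ∉ A := fun hv => h (by simpa [hS] using hA.1 hv)
        simp [h, this]
    rw [this]; exact hA.2
  · intro ω hω
    simp only [Finset.mem_filter, Finset.mem_univ, true_and] at hω ⊢
    funext v
    rw [← hω.1]
    simp only [collapse]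
    by_cases h : ω v = j
    · simp [h, hij.symm]
    · by_cases h' : ω v = i <;> simp [h, h']
  · intro A hA
    simp only [Finset.mem_filter, Finset.mem_powerset] at hA
    ext v
    simp only [Finset.mem_filter, Finset.mem_univ, true_and]
    by_cases h : b v = i
    · by_cases hv : v ∈ A <;> simp [h, hv, hij.symm]
    · have : v ∉ A := fun hv => h (by simpa [hS] using hA.1 hv)
      simp [h, this]
  · intro ω hω
    simp only [Finset.mem_filter, Finset.mem_univ, true_and] at hω
    have e1 : ∏ v, x (ω v) = (∏ v with b v ≠ i, x (ω v)) * ∏ v with b v = i, x (ω v) := by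
      rw [mul_comm, Finset.prod_filter_mul_prod_filter_not]
    have e2 : ∏ v with b v ≠ i, x (ω v) = ∏ v with b v ≠ i, x (b v) := by
      refine Finset.prod_congr rfl fun v hv => ?_
      simp only [Finset.mem_filter, Finset.mem_univ, true_and] at hv
      have := congrFun hω.1 v
      simp only [collapse] at this
      by_cases h : ω v = j
      · rw [if_pos h] at this; exact absurd this.symm hv
      · rw [if_neg h] at this; rw [this]
    have e3 : ∏ v with b v = i, x (ω v) = x i ^ counts ω i * x j ^ counts ω j := by
      rw [← Finset.prod_filter_mul_prod_filter_not (Finset.univ.filter fun v => b v = i)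
        (fun v => ω v = i)]
      have s1 : (Finset.univ.filter fun v => b v = i).filter (fun v => ω v = i) =
          Finset.univ.filter fun v => ω v = i := by
        ext v
        simp only [Finset.mem_filter, Finset.mem_univ, true_and, and_iff_right_iff_imp]
        intro h
        rw [← hω.1, collapse, h, if_neg hij]
      have s2 : (Finset.univ.filter fun v => b v = i).filter (fun v => ¬ ω v = i) =
          Finset.univ.filter fun v => ω v = j := by
        ext v
        simp only [Finset.mem_filter, Finset.mem_univ, true_and]
        rw [← hω.1, collapse]
        by_cases h : ω v = j
        · simp [h, hij.symm]
        · simp [h]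
      rw [s1, s2]
      congr 1
      · rw [Finset.prod_congr rfl (g := fun _ => x i), Finset.prod_const]; · rfl
        intro v hv; rw [(Finset.mem_filter.1 hv).2]
      · rw [Finset.prod_congr rfl (g := fun _ => x j), Finset.prod_const]; · rfl
        intro v hv; rw [(Finset.mem_filter.1 hv).2]
    rw [e1, e2, e3, hcS ω hω.1]
    rfl

end Counts

/-! ### Coupling independent assignments -/

namespace PMF

variable {V ι : Type*} [Fintype V] [Fintype ι] [DecidableEq V]

/-- The law of an assignment whose values are independent with law `p`. -/
noncomputable def iid (V : Type*) [Fintype V] [DecidableEq V] (p : PMF ι) : PMF (V → ι) :=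
  PMF.ofFintype (fun ω => ∏ v, p (ω v)) (by
    have h := Finset.prod_univ_sum (fun _ : V => (Finset.univ : Finset ι)) (fun _ a => p a)
    rw [Fintype.piFinset_univ] at h
    rw [← h]
    have hp : ∑ a, p a = 1 := by
      rw [← tsum_fintype (L := SummationFilter.unconditional _)]; exact p.tsum_coe
    simp [hp])

theorem iid_apply (p : PMF ι) (ω : V → ι) : iid V p ω = ∏ v, p (ω v) := rfl

theorem iid_map {κ : Type*} [Fintype κ] (p : PMF ι) (f : ι → κ) :
    (iid V p).map (fun ω v => f (ω v)) = iid V (p.map f) := by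
  classical
  ext η
  rw [iid_apply, PMF.map_apply, tsum_fintype]
  simp only [PMF.map_apply, tsum_fintype, ← Finset.sum_filter]
  rw [Finset.prod_univ_sum]
  trans ∑ ω : V → ι with η = fun v => f (ω v), iid V p ω
  · rw [Finset.sum_filter]
    exact Finset.sum_congr rfl fun ω _ => by congr
  refine Finset.sum_congr ?_ fun ω _ => rfl
  ext ω
  simp [funext_iff]

theorem toMeasure_iid [MeasurableSpace ι] [MeasurableSingletonClass ι] (p : PMF ι) :
    (iid V p).toMeasure = Measure.pi fun _ : V => p.toMeasure := by
  refine Measure.ext_of_singleton fun ω => ?_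
  rw [PMF.toMeasure_apply_singleton _ _ (measurableSet_singleton _), Measure.pi_singleton,
    iid_apply]
  exact Finset.prod_congr rfl fun v _ =>
    (PMF.toMeasure_apply_singleton _ _ (measurableSet_singleton _)).symm

/-- A T-transform of the weights can be matched by a T-transform of the counts. -/
theorem coupled_iid_of_tTransform [DecidableEq ι] {p q : PMF ι}
    (h : TTransform (fun a => (p a).toReal) fun a => (q a).toReal) :
    Coupled (fun ω η => TTransform (fun a => (counts ω a : ℝ)) fun a => (counts η a : ℝ))
      (iid V p) (iid V q) := by
  obtain ⟨i, j, s, h0, h1, h⟩ := h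
  set x : ι → ℝ := fun a => (p a).toReal with hx
  set y : ι → ℝ := fun a => (q a).toReal with hy
  by_cases hij : i = j
  · have : p = q := by
      ext a
      rw [← ENNReal.toReal_eq_toReal_iff' (p.apply_ne_top _) (q.apply_ne_top _)]
      have := h a
      rw [hij, Equiv.swap_self, Equiv.refl_apply] at this
      change x a = y a
      rw [this]; ring
    rw [this]
    exact Coupled.refl (fun ω => ⟨i, i, 0, le_rfl, zero_le_one, by simp⟩) _
  have yi : y i = (1 - s) * x i + s * x j := by rw [h, Equiv.swap_apply_left]
  have yj : y j = (1 - s) * x j + s * x i := by rw [h, Equiv.swap_apply_right]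
  have yo : ∀ a, a ≠ i → a ≠ j → y a = x a := by
    intro a ha hb; rw [h, Equiv.swap_apply_of_ne_of_ne ha hb]; ring
  have x0 : ∀ a, 0 ≤ x a := fun a => ENNReal.toReal_nonneg
  have y0 : ∀ a, 0 ≤ y a := fun a => ENNReal.toReal_nonneg
  have weight : ∀ (p : PMF ι) (b : V → ι) (r : ℕ),
      (iid V p).toOuterMeasure {ω | collapse i j ω = b ∧ r ≤ max (counts ω i) (counts ω j)} =
        ENNReal.ofReal (∑ ω : V → ι, if collapse i j ω = b ∧ r ≤ max (counts ω i) (counts ω j) then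
          ∏ v, (p (ω v)).toReal else 0) := by
    intro p b r
    rw [PMF.toOuterMeasure_apply_fintype, ENNReal.ofReal_sum_of_nonneg]
    · refine Finset.sum_congr rfl fun ω _ => ?_
      by_cases hω : collapse i j ω = b ∧ r ≤ max (counts ω i) (counts ω j)
      · rw [if_pos hω, Set.indicator_of_mem (by exact hω), iid_apply, ← ENNReal.toReal_prod,
          ENNReal.ofReal_toReal]
        exact ENNReal.prod_ne_top fun v _ => p.apply_ne_top _
      · rw [if_neg hω, Set.indicator_of_notMem (by exact hω), ENNReal.ofReal_zero]
    · intro ω _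
      split_ifs
      · exact Finset.prod_nonneg fun v _ => ENNReal.toReal_nonneg
      · exact le_rfl
  -- The fibres are those of the merged assignment, and the larger of the two counts is compared
  -- within each.
  refine (Coupled.of_fiber_tail_le (collapse i j)
    (fun ω => max (counts ω i) (counts ω j)) fun b r => ?_).mono ?_
  · rw [weight, weight]
    refine ENNReal.ofReal_le_ofReal ?_
    by_cases hb : ∀ v, b v ≠ j
    · refine (sum_filter_collapse_prod hij hb r y).trans_le
        (le_trans ?_ (sum_filter_collapse_prod hij hb r x).ge)
      have e : ∏ v with b v ≠ i, y (b v) = ∏ v with b v ≠ i, x (b v) :=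
        Finset.prod_congr rfl fun v hv => yo _ (Finset.mem_filter.1 hv).2 (hb v)
      rw [e]
      refine mul_le_mul_of_nonneg_left ?_ (Finset.prod_nonneg fun v _ => x0 _)
      refine foldedTail_le_foldedTail _ _ (x0 i) (x0 j) (by rw [yi, yj]; ring) ?_
      have m1 := le_max_left (x i) (x j)
      have m2 := le_max_right (x i) (x j)
      rw [yi, yj]
      refine max_le ?_ ?_ <;> nlinarith
    -- A merged assignment never takes the value `j`, so the fibre over `b` is empty.
    · have hne : ∀ ω : V → ι, collapse i j ω ≠ b := by
        rintro ω rfl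
        refine hb fun v => ?_
        simp only [collapse]
        split_ifs with hv
        · exact hij
        · exact hv
      simp [hne]
  · rintro ω η ⟨hc, hm⟩
    refine TTransform.of_transfer hij (fun a ha hb => ?_) ?_ ?_
    · rw [← counts_collapse_of_ne ha hb, ← hc, counts_collapse_of_ne ha hb]
    · have h1 := counts_collapse_add hij ω
      have h2 := counts_collapse_add hij η
      rw [← hc, ← h1] at h2
      exact_mod_cast h2
    · exact_mod_cast hm

/-- T-transforms preserve nonnegativity and total mass, so every vector along the chain is a law and
the one-step couplings can be glued. -/
theorem exists_coupled_iid_of_reflTransGen {d : ℕ} (p : PMF (Fin d)) {y : Fin d → ℝ}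
    (h : Relation.ReflTransGen TTransform (fun a => (p a).toReal) y) :
    ∃ q : PMF (Fin d), (fun a => (q a).toReal) = y ∧
      Coupled (fun ω η => Majorizes (fun a => (counts ω a : ℝ)) fun a => (counts η a : ℝ))
        (iid V p) (iid V q) := by
  induction h with
  | refl =>
    refine ⟨p, rfl, Coupled.refl (R := fun ω η : V → Fin d =>
      Majorizes (fun a => (counts ω a : ℝ)) fun a => (counts η a : ℝ)) (fun ω => ?_) _⟩
    exact Majorizes.refl _
  | @tail x y _ hxy ih =>
    obtain ⟨q, rfl, hq⟩ := ih
    have y0 := hxy.nonneg fun v => ENNReal.toReal_nonneg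
    have hsum : ∑ a, ENNReal.ofReal (y a) = 1 := by
      rw [← ENNReal.ofReal_sum_of_nonneg fun a _ => y0 a, ← hxy.sum_eq,
        ← ENNReal.toReal_sum fun a _ => q.apply_ne_top a, ENNReal.ofReal_toReal]
      · rw [← tsum_fintype (L := SummationFilter.unconditional _)]; exact q.tsum_coe
      · exact ENNReal.sum_ne_top.2 fun a _ => q.apply_ne_top a
    have hy : (fun a => (PMF.ofFintype (fun a => ENNReal.ofReal (y a)) hsum a).toReal) = y := by
      funext a
      rw [PMF.ofFintype_apply, ENNReal.toReal_ofReal (y0 a)]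
    refine ⟨PMF.ofFintype (fun a => ENNReal.ofReal (y a)) hsum, hy, ?_⟩
    refine hq.trans (fun a b c hab hbc => hab.trans (TTransform.majorizes hbc))
      (coupled_iid_of_tTransform ?_)
    rwa [hy]

theorem coupled_iid_of_majorizes {d : ℕ} {p q : PMF (Fin d)}
    (h : Majorizes (fun a => (p a).toReal) fun a => (q a).toReal) :
    Coupled (fun ω η => Majorizes (fun a => (counts ω a : ℝ)) fun a => (counts η a : ℝ))
      (iid V p) (iid V q) := by
  obtain ⟨q', hq', hc⟩ := exists_coupled_iid_of_reflTransGen (V := V) p h.reflTransGen_tTransform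
  have : q' = q := by
    ext a
    rw [← ENNReal.toReal_eq_toReal_iff' (q'.apply_ne_top _) (q.apply_ne_top _)]
    exact congrFun hq' a
  rwa [this] at hc

end PMF

/-! ### One round of an AC-process -/

theorem ACProcess.toReal_opinionLaw_map {n k : ℕ} (P : ACProcess n k) (c : Config n k) :
    (fun a => ((P.opinionLaw c).map Subtype.val a).toReal) = P.α c := by
  funext a
  rw [PMF.map_apply, tsum_fintype]
  by_cases ha : a.val < k
  · rw [Finset.sum_eq_single (⟨a, ha⟩ : Opinion n k)]
    · rw [if_pos rfl]
      exact ENNReal.toReal_ofReal (P.nonneg c a)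
    · intro b _ hb
      rw [if_neg]
      rintro rfl
      exact hb rfl
    · exact fun h => absurd (Finset.mem_univ _) h
  · rw [Finset.sum_eq_zero, ENNReal.toReal_zero, P.eq_zero_of_le c a (not_lt.1 ha)]
    intro b _
    rw [if_neg]
    rintro rfl
    exact ha b.2

theorem ACProcess.coupled_iid_opinionLaw {n k : ℕ} (P Q : ACProcess n k) (c d : Config n k)
    (hmaj : Majorizes (P.α c) (Q.α d)) :
    PMF.Coupled (fun ω η : Fin n → Opinion n k =>
        Majorizes (Config.tally ω).toReal (Config.tally η).toReal)
      (PMF.iid (Fin n) (P.opinionLaw c)) (PMF.iid (Fin n) (Q.opinionLaw d)) := by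
  refine (PMF.Coupled.of_map (f := fun (ω : Fin n → Opinion n k) v => (ω v).1)
    (g := fun (ω : Fin n → Opinion n k) v => (ω v).1)
    (R := fun ω η : Fin n → Fin n =>
      Majorizes (fun a => (counts ω a : ℝ)) fun a => (counts η a : ℝ)) ?_).mono fun ω η h => h
  rw [PMF.iid_map, PMF.iid_map]
  apply PMF.coupled_iid_of_majorizes
  rwa [P.toReal_opinionLaw_map, Q.toReal_opinionLaw_map]

theorem mainTheorem4 (n k : ℕ) (hk : k ≤ n) (P Q : ACProcess n k) (c d : Config n k)
    (hmaj : Majorizes (P.α c) (Q.α d)) :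
    ∃ (Ω : Type) (_ : MeasurableSpace Ω) (μ : Measure Ω) (X Y : Ω → Config n k),
      IsProbabilityMeasure μ ∧ Measurable X ∧ Measurable Y ∧
        μ.map X = P.stepLaw c ∧ μ.map Y = Q.stepLaw d ∧
        ∀ ω, Majorizes (X ω).toReal (Y ω).toReal := by
  classical
  obtain ⟨γ, h1, h2, h3⟩ := ACProcess.coupled_iid_opinionLaw P Q c d hmaj
  -- Majorization is known only on the support of `γ`. On the remaining null set the second
  -- configuration is replaced by the first, which makes the relation hold surely and leaves the law
  -- unchanged.
  set Y : (Fin n → Opinion n k) × (Fin n → Opinion n k) → Config n k := fun z =>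
    if Majorizes (Config.tally z.1).toReal (Config.tally z.2).toReal then Config.tally z.2
    else Config.tally z.1 with hY
  refine ⟨(Fin n → Opinion n k) × (Fin n → Opinion n k), inferInstance, γ.toMeasure,
    fun z => Config.tally z.1, Y, inferInstance, measurable_of_countable _,
    measurable_of_countable _, ?_, ?_, ?_⟩
  · rw [ACProcess.stepLaw, ← PMF.toMeasure_iid, ← h1, ← PMF.toMeasure_map _ _ measurable_fst,
      Measure.map_map ACProcess.measurable_tally measurable_fst]
    rfl
  · rw [ACProcess.stepLaw, ← PMF.toMeasure_iid, ← h2, ← PMF.toMeasure_map _ _ measurable_snd,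
      Measure.map_map ACProcess.measurable_tally measurable_snd]
    refine Measure.map_congr ?_
    have hs : ∀ᵐ z ∂γ.toMeasure, z ∈ γ.support := by
      rw [ae_iff, PMF.toMeasure_apply_eq_zero_iff _ .of_discrete]
      exact Set.disjoint_left.2 fun z hz hz' => hz' hz
    filter_upwards [hs] with z hz
    exact if_pos (h3 z hz)
  · intro z
    by_cases hz : Majorizes (Config.tally z.1).toReal (Config.tally z.2).toReal
    · simpa only [hY, if_pos hz] using hz
    · simp only [hY, if_neg hz]
      exact Majorizes.refl _
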